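/- Let $\mathbb{F}$ be an arbitrary field. A column-finite matrix indexed over $\mathbb{N}=\{0,1,2,\dots\}$ with entries in $\mathbb{F}$ is a family $A=(a_{i,j})_{(i,j)\in\mathbb{N}^2}$ of elements of $\mathbb{F}$ such that, for every $j\in\mathbb{N}$, the set $\{i\in\mathbb{N} : a_{i,j}\neq 0\}$ is finite. These matrices form an $\mathbb{F}$-algebra $\mathcal{M}_{Cf}(\mathbb{F})$ under entrywise addition and scalar multiplication and the usual matrix product $(AB)_{i,j}=\sum_{k\in\mathbb{N}} a_{i,k}b_{k,j}$ (a sum with only finitely many nonzero terms). Theorem. Let $A=(a_{i,j})\in\mathcal{M}_{Cf}(\mathbb{F})$ be strictly upper-triangular, i.e. $a_{i,j}=0$ for all $i\geq j$. Then there exist $B,C\in\mathcal{M}_{Cf}(\mathbb{F})$ such that $A=B+C$, $B^2=0$ and $C^2=0$. -/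

import Mathlib

/-- The `F`-vector space of column-finite matrices indexed over `ℕ`: the families
`(a i j)` of elements of `F` such that `{i | a i j ≠ 0}` is finite for every `j`. -/
def ColumnFiniteMatrix (F : Type*) [Field F] : Submodule F (Matrix ℕ ℕ F) where
  carrier := {A | ∀ j, {i | A i j ≠ 0}.Finite}
  zero_mem' := by
    intro j
    simp
  add_mem' := by
    intro A B hA hB j
    refine ((hA j).union (hB j)).subset ?_
    intro i hi
    by_contra h
    simp only [Set.mem_union, Set.mem_ofPred_eq, not_or, not_not] at h
    exact hi (by simp [h.1, h.2])
  smul_mem' := by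
    intro c A hA j
    refine (hA j).subset ?_
    intro i hi h
    exact hi (by simp [h])

namespace ColumnFiniteMatrix

variable {F : Type*} [Field F]

/-- The entries of the second factor in a given column have finite support, so that the sum
defining an entry of a product has only finitely many nonzero terms. -/
theorem finite_support_mul (A B : ColumnFiniteMatrix F) (i j : ℕ) :
    (Function.support fun k => A.1 i k * B.1 k j).Finite :=
  (B.2 j).subset fun _ hk h => hk (by simp [h])

/-- The product of column-finite matrices is column-finite. -/
theorem finite_column_mul (A B : ColumnFiniteMatrix F) (j : ℕ) :
    {i | (∑ᶠ k, A.1 i k * B.1 k j) ≠ 0}.Finite := by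
  refine ((B.2 j).biUnion fun k _ => A.2 k).subset ?_
  intro i hi
  obtain ⟨k, hk⟩ : ∃ k, A.1 i k * B.1 k j ≠ 0 := by
    by_contra! h
    exact hi (finsum_eq_zero_of_forall_eq_zero h)
  simp only [Set.mem_iUnion]
  exact ⟨k, right_ne_zero_of_mul hk, left_ne_zero_of_mul hk⟩

/-- The usual matrix product, `(A * B) i j = ∑ k, A i k * B k j`; the sum is finite by
`finite_support_mul`. -/
noncomputable instance : Mul (ColumnFiniteMatrix F) where
  mul A B := ⟨Matrix.of fun i j => ∑ᶠ k, A.1 i k * B.1 k j, finite_column_mul A B⟩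

theorem mul_apply (A B : ColumnFiniteMatrix F) (i j : ℕ) :
    (A * B).1 i j = ∑ᶠ k, A.1 i k * B.1 k j := rfl

/-- All entries on and below the diagonal vanish. -/
def IsStrictlyUpperTriangular (A : ColumnFiniteMatrix F) : Prop :=
  ∀ i j : ℕ, j ≤ i → A.1 i j = 0

/-- `A ^ 2 = 0` in the algebra of column-finite matrices. -/
def IsSquareZero (A : ColumnFiniteMatrix F) : Prop :=
  A * A = 0

end ColumnFiniteMatrix

/-! A strictly triangular `u` is odd for some grading V = V₀ ⊕ V₁; composing `u` with the two
projections then gives the square-zero summands (`exists_sq_zero_add_of_isCompl`).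

The grading is built in the spirit of the Kaplansky–Mackey proof of Ulm's theorem: basis vectors are
absorbed one at a time into finite-dimensional graded pieces on which `u` is odd. Height is measured
by the chain of transfinite images of `u`, and the invariant `IsNice` says that components are at
least as high as their sum. Hence the components v₀, v₁ of u x can be lifted separately, at least as
high as a suitably adjusted x (`exists_extension`). Placing each lift in the part opposite to its
image keeps `u` odd; choosing lifts of maximal height modulo the current piece keeps the invariant.
-/

section HeightChain

variable {F V : Type*} [Field F] [AddCommGroup V] [Module F V]

/-- The transfinite chain of iterated images of `u`, together with `⊥`. -/
inductive IsHeight (u : V →ₗ[F] V) : Submodule F V → Prop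
  | bot : IsHeight u ⊥
  | map {W : Submodule F V} : IsHeight u W → IsHeight u (W.map u)
  | sInf {A : Set (Submodule F V)} : (∀ W ∈ A, IsHeight u W) → IsHeight u (sInf A)

/-! ### Total order on the chain of heights -/

namespace IsHeight

variable {u : V →ₗ[F] V} {W W' : Submodule F V}

theorem map_le (hW : IsHeight u W) : W.map u ≤ W := by
  induction hW with
  | bot => simp
  | map _ ih => exact Submodule.map_mono ih
  | sInf _ ih =>
    exact le_sInf fun W h => (Submodule.map_mono (sInf_le h)).trans (ih W h)

/-- Inner half of the Bourbaki–Witt tower argument, which gives comparability without ordinals: no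
member lies strictly between `W.map u` and `W`. -/
theorem le_map_or_ge_of_forall
    (h : ∀ W', IsHeight u W' → W ≤ W'.map u ∨ W' ≤ W) (hW' : IsHeight u W') :
    W' ≤ W.map u ∨ W ≤ W' := by
  induction hW' with
  | bot => exact Or.inl bot_le
  | map hY ih =>
    rcases ih with ih | ih
    · exact Or.inl (hY.map_le.trans ih)
    · rcases h _ hY with h | h
      · exact Or.inr h
      · exact Or.inl (Submodule.map_mono h)
  | @sInf A _ ih =>
    by_cases hA : ∀ b ∈ A, W ≤ b
    · exact Or.inr (le_sInf hA)
    · push Not at hA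
      obtain ⟨b, hb, hWb⟩ := hA
      exact Or.inl ((sInf_le hb).trans ((ih b hb).resolve_right hWb))

theorem le_map_or_ge (hW : IsHeight u W) :
    ∀ W', IsHeight u W' → W ≤ W'.map u ∨ W' ≤ W := by
  induction hW with
  | bot => exact fun _ _ => Or.inl bot_le
  | map hX ih =>
    intro W' hW'
    rcases le_map_or_ge_of_forall ih hW' with h | h
    · exact Or.inr h
    · exact Or.inl (Submodule.map_mono h)
  | @sInf A _ ih =>
    intro W' hW'
    by_cases hA : ∀ a ∈ A, W' ≤ a
    · exact Or.inr (le_sInf hA)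
    · push Not at hA
      obtain ⟨a, ha, hWa⟩ := hA
      exact Or.inl ((sInf_le ha).trans ((ih a ha W' hW').resolve_right hWa))

theorem total (hW : IsHeight u W) (hW' : IsHeight u W') : W ≤ W' ∨ W' ≤ W :=
  (hW.le_map_or_ge W' hW').imp_left fun h => h.trans hW'.map_le

theorem exists_smallest (u : V →ₗ[F] V) (x : V) :
    ∃ W, IsHeight u W ∧ x ∈ W ∧ ∀ W', IsHeight u W' → x ∈ W' → W ≤ W' := by
  refine ⟨_, IsHeight.sInf (A := {W | IsHeight u W ∧ x ∈ W}) fun W hW => hW.1, ?_, ?_⟩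
  · exact (Submodule.mem_sInf).2 fun W hW => hW.2
  · exact fun W' h h' => sInf_le ⟨h, h'⟩

/-- Among the members of the chain with a given property, one has the least trace on a given
finite-dimensional subspace. -/
theorem exists_min_trace (E : Submodule F V) [FiniteDimensional F E]
    (P : Submodule F V → Prop) (hP : ∃ W, IsHeight u W ∧ P W) :
    ∃ W, IsHeight u W ∧ P W ∧ ∀ W', IsHeight u W' → P W' → E ⊓ W ≤ W' := by
  classical
  -- `P` need not pass to intersections, so a least member may not exist; minimizing the dimension
  -- of the trace replaces it.
  obtain ⟨W, ⟨hW, hPW⟩, hmin⟩ := exists_minimalFor_of_wellFoundedLT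
    (fun W => IsHeight u W ∧ P W) (fun W => Module.finrank F (E ⊓ W : Submodule F V)) hP
  refine ⟨W, hW, hPW, fun W' hW' hPW' => ?_⟩
  rcases hW.total hW' with h | h
  · exact inf_le_right.trans h
  · have hle : E ⊓ W' ≤ E ⊓ W := inf_le_inf_left E h
    have : FiniteDimensional F (E ⊓ W : Submodule F V) :=
      Submodule.finiteDimensional_of_le inf_le_left
    have := Submodule.eq_of_le_of_finrank_le hle
      (hmin ⟨hW', hPW'⟩ (Submodule.finrank_mono hle))
    exact this ▸ inf_le_right

end IsHeight

/-! ### Proper elements and nice gradings -/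

/-- `z` has the greatest height in its coset modulo `S`. -/
def IsProper (u : V →ₗ[F] V) (S : Submodule F V) (z : V) : Prop :=
  ∀ W, IsHeight u W → ∀ s ∈ S, z + s ∈ W → z ∈ W

theorem exists_isProper (u : V →ₗ[F] V) (S : Submodule F V) [FiniteDimensional F S] (x : V) :
    ∃ s ∈ S, IsProper u S (x + s) := by
  obtain ⟨W, hW, ⟨s, hs, hxs⟩, hmin⟩ := IsHeight.exists_min_trace (u := u) S
    (fun W => ∃ s ∈ S, x + s ∈ W)
    ⟨sInf ∅, IsHeight.sInf (by simp), 0, S.zero_mem, by simp⟩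
  refine ⟨s, hs, fun W' hW' t ht h => ?_⟩
  rcases hW.total hW' with hle | hle
  · exact hle hxs
  · have htW : t ∈ W := by simpa using W.sub_mem (hle h) hxs
    have := hmin W' hW' ⟨s + t, S.add_mem hs ht, by rwa [← add_assoc]⟩ ⟨ht, htW⟩
    simpa using W'.sub_mem h this

/-- A translation inside `S` by an element at least as high as `x` keeps the maximal height of the
coset. -/
theorem IsProper.add {u : V →ₗ[F] V} {S W : Submodule F V} {x t : V} (hx : IsProper u S x)
    (hmin : ∀ W', IsHeight u W' → x ∈ W' → W ≤ W') (hxW : x ∈ W) (htS : t ∈ S) (htW : t ∈ W) :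
    IsProper u S (x + t) := fun W' hW' s hs h =>
  hmin W' hW' (hx W' hW' (t + s) (S.add_mem htS hs) (by rwa [← add_assoc])) (W.add_mem hxW htW)

/-- `S₀` and `S₁` form a `ℤ/2`-grading of a subspace, for which `u` is odd, and whose components
do not decrease heights. -/
structure IsNice (u : V →ₗ[F] V) (S₀ S₁ : Submodule F V) : Prop where
  map₀ : ∀ s ∈ S₀, u s ∈ S₁
  map₁ : ∀ s ∈ S₁, u s ∈ S₀
  left_mem : ∀ W, IsHeight u W → ∀ s ∈ S₀, ∀ t ∈ S₁, s + t ∈ W → s ∈ W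

namespace IsNice

variable {u : V →ₗ[F] V} {S₀ S₁ : Submodule F V}

theorem right_mem (h : IsNice u S₀ S₁) (W : Submodule F V) (hW : IsHeight u W) (s : V)
    (hs : s ∈ S₀) (t : V) (ht : t ∈ S₁) (hst : s + t ∈ W) : t ∈ W := by
  simpa using W.sub_mem hst (h.left_mem W hW s hs t ht hst)

theorem symm (h : IsNice u S₀ S₁) : IsNice u S₁ S₀ where
  map₀ := h.map₁
  map₁ := h.map₀
  left_mem W hW s hs t ht hst := h.right_mem W hW t ht s hs (by rwa [add_comm])

/-- If `z` occurs with nonzero coefficient in an element of `W`, properness puts `z` itself in `W`,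
and subtracting it returns to the old grading. -/
theorem adjoin (h : IsNice u S₀ S₁) {z : V} (hz : IsProper u (S₀ ⊔ S₁) z) (huz : u z ∈ S₁) :
    IsNice u (S₀ ⊔ F ∙ z) S₁ where
  map₀ s hs := by
    obtain ⟨s, hs', _, hz', rfl⟩ := Submodule.mem_sup.1 hs
    obtain ⟨a, rfl⟩ := Submodule.mem_span_singleton.1 hz'
    rw [map_add, map_smul]
    exact S₁.add_mem (h.map₀ s hs') (S₁.smul_mem a huz)
  map₁ s hs := Submodule.mem_sup_left (h.map₁ s hs)
  left_mem W hW s hs t ht hst := by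
    obtain ⟨s, hs', _, hz', rfl⟩ := Submodule.mem_sup.1 hs
    obtain ⟨a, rfl⟩ := Submodule.mem_span_singleton.1 hz'
    by_cases ha : a = 0
    · subst ha
      simp only [zero_smul, add_zero] at hst ⊢
      exact h.left_mem W hW s hs' t ht hst
    · have hzW : z ∈ W := by
        refine hz W hW (a⁻¹ • (s + t)) (Submodule.smul_mem _ _
          (Submodule.add_mem_sup hs' ht)) ?_
        convert W.smul_mem a⁻¹ hst using 1
        rw [show s + a • z + t = a • z + (s + t) by abel, smul_add _ (a • z),
          inv_smul_smul₀ ha]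
      refine W.add_mem (h.left_mem W hW s hs' t ht ?_) (W.smul_mem a hzW)
      convert W.sub_mem hst (W.smul_mem a hzW) using 1
      abel

/-- If `v` is proper modulo the image of `S₁ ⊓ W`, then adding to `v` the image of an element of
`W` does not increase its height in the image of `u`. -/
theorem mem_map_of_add (h : IsNice u S₀ S₁) {W : Submodule F V} (hW : IsHeight u W) {v y : V}
    (hv : v ∈ S₀) (hvp : IsProper u ((S₁ ⊓ W).map u) v) (hy : y ∈ W) (huy : u y ∈ S₁) :
    ∀ r ∈ (S₀ ⊔ S₁) ⊔ F ∙ y, r ∈ W → ∀ W', IsHeight u W' → v + u r ∈ W'.map u →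
      v ∈ W'.map u := by
  intro r hr hrW W' hW' hvr
  obtain ⟨s, hs, _, hz', rfl⟩ := Submodule.mem_sup.1 hr
  obtain ⟨a, rfl⟩ := Submodule.mem_span_singleton.1 hz'
  obtain ⟨s₀, hs₀, s₁, hs₁, rfl⟩ := Submodule.mem_sup.1 hs
  have hsW : s₀ + s₁ ∈ W := by simpa using W.sub_mem hrW (W.smul_mem a hy)
  have hs₁W := h.right_mem W hW s₀ hs₀ s₁ hs₁ hsW
  refine hvp _ hW'.map (u s₁) ⟨s₁, ⟨hs₁, hs₁W⟩, rfl⟩ ?_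
  -- The terms u s₀ and a • u y lie in `S₁`, so niceness strips them off.
  refine h.left_mem _ hW'.map _ (S₀.add_mem hv (h.map₁ s₁ hs₁)) (u s₀ + a • u y)
    (S₁.add_mem (h.map₀ s₀ hs₀) (S₁.smul_mem a huy)) ?_
  convert hvr using 1
  simp only [map_add, map_smul]
  abel

end IsNice

/-- If y + r were higher than y, applying `u` and `hres` would put v in the image of that higher
member; by `hmin` it then contains r, hence y. -/
theorem isProper_of_min_trace {u : V →ₗ[F] V} {E R W W₁ : Submodule F V} {v y : V} (hRE : R ≤ E)
    (hres : ∀ r ∈ R, r ∈ W → ∀ W', IsHeight u W' → v + u r ∈ W'.map u → v ∈ W'.map u)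
    (hW₁ : IsHeight u W₁) (hle : W₁ ≤ W) (hy : y ∈ W₁) (huy : u y = v)
    (hmin : ∀ W', IsHeight u W' → v ∈ W'.map u → E ⊓ W₁ ≤ W') : IsProper u R y := by
  intro W' hW' r hr h
  rcases hW₁.total hW' with hle' | hle'
  · exact hle' hy
  · have hrW : r ∈ W₁ := by simpa using W₁.sub_mem (hle' h) hy
    have := hres r hr (hle hrW) W' hW' ⟨y + r, h, by rw [map_add, huy]⟩
    simpa using W'.sub_mem h (hmin W' hW' this ⟨hRE hr, hrW⟩)

theorem IsHeight.exists_le_min_trace {u : V →ₗ[F] V} {W : Submodule F V} (hW : IsHeight u W)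
    (E : Submodule F V) [FiniteDimensional F E] {v : V} (hv : v ∈ W.map u) :
    ∃ W₁, IsHeight u W₁ ∧ W₁ ≤ W ∧ v ∈ W₁.map u ∧
      ∀ W', IsHeight u W' → v ∈ W'.map u → E ⊓ W₁ ≤ W' := by
  obtain ⟨W₁, h₁, ⟨hle, hv₁⟩, hmin⟩ := IsHeight.exists_min_trace (u := u) E
    (fun W₁ => W₁ ≤ W ∧ v ∈ W₁.map u) ⟨W, hW, le_rfl, hv⟩
  refine ⟨W₁, h₁, hle, hv₁, fun W' hW' hv' => ?_⟩
  rcases hW.total hW' with h | h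
  · exact inf_le_right.trans (hle.trans h)
  · exact hmin W' hW' ⟨h, hv'⟩

/-! ### Extending a nice grading by one vector -/

namespace IsNice

variable {u : V →ₗ[F] V} {S₀ S₁ : Submodule F V}

/-- The case of the extension step in which `x` itself is as high as the preimages of the even
part of `u x`. -/
theorem exists_extension_of_mem (h : IsNice u S₀ S₁) {W E W₁ : Submodule F V} {x v₀ v₁ : V}
    (hW : IsHeight u W) (hxW : x ∈ W) (hxmin : ∀ W', IsHeight u W' → x ∈ W' → W ≤ W')
    (hux : u x = v₀ + v₁) (hv₀ : v₀ ∈ S₀) (hv₁ : v₁ ∈ S₁)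
    (hp₀ : IsProper u ((S₁ ⊓ W).map u) v₀) (hp₁ : IsProper u ((S₀ ⊓ W).map u) v₁)
    (hx₀ : ∀ W', IsHeight u W' → v₀ ∈ W'.map u → x ∈ W')
    (hE : S₀ ⊔ S₁ ≤ E) (hW₁ : IsHeight u W₁) (hle : W₁ ≤ W) (hvW₁ : v₁ ∈ W₁.map u)
    (hmin : ∀ W', IsHeight u W' → v₁ ∈ W'.map u → E ⊓ W₁ ≤ W') :
    ∃ y₀ y₁, x = y₀ + y₁ ∧ IsNice u (S₀ ⊔ F ∙ y₁) (S₁ ⊔ F ∙ y₀) := by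
  obtain ⟨y₁, hy₁, huy₁⟩ := hvW₁
  have hp : IsProper u (S₀ ⊔ S₁) y₁ := by
    refine isProper_of_min_trace hE (fun r hr => ?_) hW₁ hle hy₁ huy₁ hmin
    refine h.symm.mem_map_of_add hW hv₁ hp₁ W.zero_mem (by simp) r ?_
    rw [sup_comm S₁]
    exact Submodule.mem_sup_left hr
  have hnice := h.adjoin hp (huy₁ ▸ hv₁)
  have huy₀ : u (x - y₁) = v₀ := by rw [map_sub, hux, huy₁]; abel
  refine ⟨x - y₁, y₁, by abel, (hnice.symm.adjoin ?_ (Submodule.mem_sup_left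
    (huy₀ ▸ hv₀))).symm⟩
  intro W' hW' r hr hyr
  have hyW : x - y₁ ∈ W := W.sub_mem hxW (hle hy₁)
  rcases hW.total hW' with hle' | hle'
  · exact hle' hyW
  · have hrW : r ∈ W := by simpa using W.sub_mem (hle' hyr) hyW
    -- A higher element of the coset of `x - y₁` would make v₀, hence x, higher too, against the
    -- minimality of `W`.
    refine hxmin W' hW' (hx₀ W' hW' ?_) hyW
    refine h.mem_map_of_add hW hv₀ hp₀ (hle hy₁) (huy₁ ▸ hv₁) r ?_ hrW W' hW'
      ⟨x - y₁ + r, hyr, by rw [map_add, huy₀]⟩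
    convert hr using 1
    ac_rfl

/-- The case of the extension step in which `x` is lower than the preimages of both parts
of `u x`. -/
theorem exists_extension_of_notMem (h : IsNice u S₀ S₁) {W E W₀ W₁ : Submodule F V}
    [FiniteDimensional F E] {x v₀ v₁ : V}
    (hx : IsProper u (S₀ ⊔ S₁) x) (hW : IsHeight u W)
    (hux : u x = v₀ + v₁) (hv₀ : v₀ ∈ S₀) (hv₁ : v₁ ∈ S₁)
    (hp₀ : IsProper u ((S₁ ⊓ W).map u) v₀) (hp₁ : IsProper u ((S₀ ⊓ W).map u) v₁)
    (hE : S₀ ⊔ S₁ ≤ E) (hxE : x ∈ E)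
    (hW₀ : IsHeight u W₀) (hle₀ : W₀ ≤ W) (hvW₀ : v₀ ∈ W₀.map u)
    (hmin₀ : ∀ W', IsHeight u W' → v₀ ∈ W'.map u → E ⊓ W₀ ≤ W') (hx₀ : x ∉ W₀)
    (hW₁ : IsHeight u W₁) (hle₁ : W₁ ≤ W) (hvW₁ : v₁ ∈ W₁.map u) (hx₁ : x ∉ W₁) :
    ∃ y₀ y₁ k, x = y₀ + y₁ + k ∧ IsNice u (S₀ ⊔ F ∙ y₁) (S₁ ⊔ F ∙ y₀ ⊔ F ∙ k) := by
  obtain ⟨y₀, hy₀, huy₀⟩ := hvW₀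
  have hp : IsProper u (S₀ ⊔ S₁) y₀ := by
    refine isProper_of_min_trace hE (fun r hr => ?_) hW₀ hle₀ hy₀ huy₀ hmin₀
    exact h.mem_map_of_add hW hv₀ hp₀ W.zero_mem (by simp) r (Submodule.mem_sup_left hr)
  have hnice : IsNice u S₀ (S₁ ⊔ F ∙ y₀) :=
    (h.symm.adjoin (by rwa [sup_comm]) (huy₀ ▸ hv₀)).symm
  -- The lift of v₁ is chosen afresh because it must be proper modulo `y₀` as well.
  obtain ⟨W₂, hW₂, hle₂, ⟨y₁, hy₁, huy₁⟩, hmin₂⟩ :=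
    hW.exists_le_min_trace (E ⊔ F ∙ y₀) ((Submodule.map_mono hle₁) hvW₁)
  have hx₂ : x ∉ W₂ := fun hx₂ => hx₁ (hmin₂ W₁ hW₁ hvW₁ ⟨Submodule.mem_sup_left hxE, hx₂⟩)
  have hp' : IsProper u (S₀ ⊔ (S₁ ⊔ F ∙ y₀)) y₁ := by
    rw [← sup_assoc]
    refine isProper_of_min_trace (sup_le_sup_right hE _) (fun r hr => ?_) hW₂ hle₂ hy₁ huy₁ hmin₂
    refine h.symm.mem_map_of_add hW hv₁ hp₁ (hle₀ hy₀) (huy₀ ▸ hv₀) r ?_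
    rwa [sup_comm S₁]
  have hnice' := hnice.adjoin hp' (Submodule.mem_sup_left (huy₁ ▸ hv₁))
  refine ⟨y₀, y₁, x - y₀ - y₁, by abel, (hnice'.symm.adjoin ?_ ?_).symm⟩
  · intro W' hW' r hr hkr
    obtain ⟨p, hp, q, hq, rfl⟩ := Submodule.mem_sup.1 hr
    obtain ⟨s₁, hs₁, _, hz, rfl⟩ := Submodule.mem_sup.1 hp
    obtain ⟨a, rfl⟩ := Submodule.mem_span_singleton.1 hz
    obtain ⟨s₀, hs₀, _, hz, rfl⟩ := Submodule.mem_sup.1 hq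
    obtain ⟨b, rfl⟩ := Submodule.mem_span_singleton.1 hz
    have key : ∀ M, IsHeight u M → y₀ ∈ M → y₁ ∈ M → W' ≤ M → x ∈ M := by
      intro M hM h₀ h₁ hle
      refine hx M hM (s₀ + s₁) (Submodule.add_mem_sup hs₀ hs₁) ?_
      convert M.add_mem (M.add_mem (hle hkr) (M.smul_mem (1 - a) h₀)) (M.smul_mem (1 - b) h₁)
        using 1
      module
    have hnot₀ : ¬ (W₂ ≤ W₀ ∧ W' ≤ W₀) := fun hl => hx₀ (key W₀ hW₀ hy₀ (hl.1 hy₁) hl.2)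
    have hnot₂ : ¬ (W₀ ≤ W₂ ∧ W' ≤ W₂) := fun hl => hx₂ (key W₂ hW₂ (hl.1 hy₀) hy₁ hl.2)
    -- Otherwise the larger of `W₀`, `W₂` contains `W'`, `y₀` and `y₁`, hence x by properness, a
    -- contradiction.
    have hboth : W₀ ≤ W' ∧ W₂ ≤ W' := by
      rcases hW₀.total hW₂ with hl | hl
      · have := (hW₂.total hW').resolve_right fun h' => hnot₂ ⟨hl, h'⟩
        exact ⟨hl.trans this, this⟩
      · have := (hW₀.total hW').resolve_right fun h' => hnot₀ ⟨hl, h'⟩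
        exact ⟨this, hl.trans this⟩
    have hy₀' := hboth.1 hy₀
    have hy₁' := hboth.2 hy₁
    exact W'.sub_mem (W'.sub_mem (key W' hW' hy₀' hy₁' le_rfl) hy₀') hy₁'
  · rw [map_sub, map_sub, hux, huy₀, huy₁]
    simp

theorem exists_extension (h : IsNice u S₀ S₁) [FiniteDimensional F S₀] [FiniteDimensional F S₁]
    {x : V} (hx : u x ∈ S₀ ⊔ S₁) :
    ∃ T₀ T₁ : Submodule F V, S₀ ≤ T₀ ∧ S₁ ≤ T₁ ∧ FiniteDimensional F T₀ ∧
      FiniteDimensional F T₁ ∧ IsNice u T₀ T₁ ∧ x ∈ T₀ ⊔ T₁ := by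
  suffices H : ∃ s ∈ S₀ ⊔ S₁, ∃ T₀ T₁ : Submodule F V, S₀ ≤ T₀ ∧ S₁ ≤ T₁ ∧
      FiniteDimensional F T₀ ∧ FiniteDimensional F T₁ ∧ IsNice u T₀ T₁ ∧ x + s ∈ T₀ ⊔ T₁ by
    obtain ⟨s, hs, T₀, T₁, h₀, h₁, hf₀, hf₁, hn, hm⟩ := H
    refine ⟨T₀, T₁, h₀, h₁, hf₀, hf₁, hn, ?_⟩
    simpa using Submodule.sub_mem _ hm (sup_le_sup h₀ h₁ hs)
  obtain ⟨s, hs, hxs⟩ := exists_isProper u (S₀ ⊔ S₁) x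
  obtain ⟨W, hW, hxW, hWmin⟩ := IsHeight.exists_smallest u (x + s)
  have hus : u s ∈ S₀ ⊔ S₁ := by
    obtain ⟨s₀, hs₀, s₁, hs₁, rfl⟩ := Submodule.mem_sup.1 hs
    rw [map_add, add_comm]
    exact Submodule.add_mem_sup (h.map₁ s₁ hs₁) (h.map₀ s₀ hs₀)
  obtain ⟨c₀, hc₀, c₁, hc₁, hc⟩ := Submodule.mem_sup.1 (show u (x + s) ∈ S₀ ⊔ S₁ by
    rw [map_add]; exact Submodule.add_mem _ hx hus)
  have : FiniteDimensional F (S₀ ⊓ W : Submodule F V) :=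
    Submodule.finiteDimensional_of_le inf_le_left
  have : FiniteDimensional F (S₁ ⊓ W : Submodule F V) :=
    Submodule.finiteDimensional_of_le inf_le_left
  -- Translating x + s by t₀ + t₁, which lies in `W`, makes both components of its image proper
  -- without changing its height.
  obtain ⟨_, ⟨t₁, ⟨ht₁, ht₁W⟩, rfl⟩, hp₀⟩ := exists_isProper u ((S₁ ⊓ W).map u) c₀
  obtain ⟨_, ⟨t₀, ⟨ht₀, ht₀W⟩, rfl⟩, hp₁⟩ := exists_isProper u ((S₀ ⊓ W).map u) c₁
  have htS : t₀ + t₁ ∈ S₀ ⊔ S₁ := Submodule.add_mem_sup ht₀ ht₁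
  have htW : t₀ + t₁ ∈ W := W.add_mem ht₀W ht₁W
  have hprop := hxs.add hWmin hxW htS htW
  have hmin : ∀ W', IsHeight u W' → x + s + (t₀ + t₁) ∈ W' → W ≤ W' := fun W' hW' h' =>
    hWmin W' hW' (hxs W' hW' _ htS h')
  have hmem := W.add_mem hxW htW
  have hu : u (x + s + (t₀ + t₁)) = (c₀ + u t₁) + (c₁ + u t₀) := by
    rw [map_add, ← hc, map_add]; abel
  have hv₀ : c₀ + u t₁ ∈ S₀ := S₀.add_mem hc₀ (h.map₁ t₁ ht₁)
  have hv₁ : c₁ + u t₀ ∈ S₁ := S₁.add_mem hc₁ (h.map₀ t₀ ht₀)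
  refine ⟨s + (t₀ + t₁), Submodule.add_mem _ hs htS, ?_⟩
  rw [← add_assoc]
  generalize x + s + (t₀ + t₁) = z at hprop hmin hmem hu
  generalize c₀ + u t₁ = v₀ at hp₀ hu hv₀
  generalize c₁ + u t₀ = v₁ at hp₁ hu hv₁
  have huW : v₀ + v₁ ∈ W.map u := ⟨z, hmem, hu⟩
  have hE : S₀ ⊔ S₁ ≤ S₀ ⊔ S₁ ⊔ F ∙ z := le_sup_left
  have hzE : z ∈ S₀ ⊔ S₁ ⊔ F ∙ z := Submodule.mem_sup_right (Submodule.mem_span_singleton_self z)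
  obtain ⟨W₀, hW₀, hle₀, hvW₀, hmin₀⟩ := hW.exists_le_min_trace (S₀ ⊔ S₁ ⊔ F ∙ z)
    (h.left_mem _ hW.map _ hv₀ _ hv₁ huW)
  obtain ⟨W₁, hW₁, hle₁, hvW₁, hmin₁⟩ := hW.exists_le_min_trace (S₀ ⊔ S₁ ⊔ F ∙ z)
    (h.right_mem _ hW.map _ hv₀ _ hv₁ huW)
  have hself : ∀ y : V, y ∈ F ∙ y := Submodule.mem_span_singleton_self
  by_cases hx₀ : z ∈ W₀
  · obtain ⟨y₀, y₁, hy, hn⟩ := h.exists_extension_of_mem hW hmem hmin hu hv₀ hv₁ hp₀ hp₁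
      (fun W' hW' h' => hmin₀ W' hW' h' ⟨hzE, hx₀⟩) hE hW₁ hle₁ hvW₁ hmin₁
    refine ⟨_, _, le_sup_left, le_sup_left, inferInstance, inferInstance, hn, ?_⟩
    rw [hy, add_comm]
    exact Submodule.add_mem_sup (Submodule.mem_sup_right (hself _))
      (Submodule.mem_sup_right (hself _))
  by_cases hx₁ : z ∈ W₁
  · obtain ⟨y₀, y₁, hy, hn⟩ := h.symm.exists_extension_of_mem hW hmem hmin
      (hu.trans (add_comm _ _)) hv₁ hv₀ hp₁ hp₀
      (fun W' hW' h' => hmin₁ W' hW' h' ⟨hzE, hx₁⟩) ((sup_comm _ _).trans_le hE)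
      hW₀ hle₀ hvW₀ hmin₀
    refine ⟨_, _, le_sup_left, le_sup_left, inferInstance, inferInstance, hn.symm, ?_⟩
    rw [hy]
    exact Submodule.add_mem_sup (Submodule.mem_sup_right (hself _))
      (Submodule.mem_sup_right (hself _))
  · obtain ⟨y₀, y₁, k, hy, hn⟩ := h.exists_extension_of_notMem hprop hW hu hv₀ hv₁ hp₀ hp₁
      hE hzE hW₀ hle₀ hvW₀ hmin₀ hx₀ hW₁ hle₁ hvW₁ hx₁
    refine ⟨_, _, le_sup_left, le_sup_left.trans le_sup_left, inferInstance, inferInstance,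
      hn, ?_⟩
    rw [hy, show y₀ + y₁ + k = y₁ + (y₀ + k) by abel]
    exact Submodule.add_mem_sup (Submodule.mem_sup_right (hself _))
      (Submodule.add_mem_sup (Submodule.mem_sup_right (hself _)) (hself _))

end IsNice

/-! ### Gluing the finite-dimensional gradings -/

/-- An endomorphism that is strictly triangular with respect to a sequence spanning the space is
odd for some `ℤ/2`-grading of the space. -/
theorem exists_isCompl_of_strictlyTriangular (u : V →ₗ[F] V) (e : ℕ → V)
    (he : Submodule.span F (Set.range e) = ⊤)
    (hu : ∀ n, u (e n) ∈ Submodule.span F (e '' Set.Iio n)) :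
    ∃ V₀ V₁ : Submodule F V, IsCompl V₀ V₁ ∧ (∀ x ∈ V₀, u x ∈ V₁) ∧ ∀ x ∈ V₁, u x ∈ V₀ := by
  let P := {S : Submodule F V × Submodule F V //
    FiniteDimensional F S.1 ∧ FiniteDimensional F S.2 ∧ IsNice u S.1 S.2}
  have hstep : ∀ (S : P) (x : V), ∃ T : P, S.1 ≤ T.1 ∧
      (u x ∈ S.1.1 ⊔ S.1.2 → x ∈ T.1.1 ⊔ T.1.2) := by
    rintro ⟨⟨S₀, S₁⟩, hf₀, hf₁, hn⟩ x
    by_cases hx : u x ∈ S₀ ⊔ S₁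
    · obtain ⟨T₀, T₁, h₀, h₁, hf₀, hf₁, hn, hm⟩ := hn.exists_extension hx
      exact ⟨⟨⟨T₀, T₁⟩, hf₀, hf₁, hn⟩, ⟨h₀, h₁⟩, fun _ => hm⟩
    · exact ⟨⟨⟨S₀, S₁⟩, hf₀, hf₁, hn⟩, le_rfl, fun h => absurd h hx⟩
  choose next hle hmem using hstep
  let start : P := ⟨⟨⊥, ⊥⟩, inferInstance, inferInstance,
    ⟨by simp, by simp, fun W _ s hs t _ _ => by
      rw [(Submodule.mem_bot F).1 hs]; exact W.zero_mem⟩⟩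
  let S : ℕ → P := fun n => Nat.rec start (fun n T => next T (e n)) n
  have hmono : Monotone fun n => (S n).1 := monotone_nat_of_le_succ fun n => hle (S n) (e n)
  have hm₀ : Monotone fun n => (S n).1.1 := fun m n h => (hmono h).1
  have hm₁ : Monotone fun n => (S n).1.2 := fun m n h => (hmono h).2
  have hsup : Monotone fun n => (S n).1.1 ⊔ (S n).1.2 := fun m n h => sup_le_sup (hm₀ h) (hm₁ h)
  have hin : ∀ n, e n ∈ (S (n + 1)).1.1 ⊔ (S (n + 1)).1.2 := by
    intro n
    induction n using Nat.strong_induction_on with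
    | _ n ih =>
      refine hmem (S n) (e n) ((Submodule.span_le.2 ?_) (hu n))
      rintro _ ⟨m, hmn, rfl⟩
      exact hsup (Nat.succ_le_of_lt hmn) (ih m hmn)
  have hmem₀ : ∀ x, x ∈ ⨆ n, (S n).1.1 ↔ ∃ n, x ∈ (S n).1.1 := fun x =>
    Submodule.mem_iSup_of_directed _ hm₀.directed_le
  have hmem₁ : ∀ x, x ∈ ⨆ n, (S n).1.2 ↔ ∃ n, x ∈ (S n).1.2 := fun x =>
    Submodule.mem_iSup_of_directed _ hm₁.directed_le
  refine ⟨⨆ n, (S n).1.1, ⨆ n, (S n).1.2, ⟨?_, ?_⟩, ?_, ?_⟩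
  · rw [Submodule.disjoint_def]
    intro x hx hx'
    obtain ⟨m, hm⟩ := (hmem₀ x).1 hx
    obtain ⟨n, hn⟩ := (hmem₁ x).1 hx'
    -- Niceness at height `⊥` says exactly that the sum is direct; this is why `⊥` belongs to the
    -- chain.
    have := (S (max m n)).2.2.2.left_mem ⊥ IsHeight.bot x (hm₀ (le_max_left m n) hm) (-x)
      (Submodule.neg_mem _ (hm₁ (le_max_right m n) hn)) (by simp)
    simpa using this
  · rw [codisjoint_iff_le_sup, ← he, Submodule.span_le]
    rintro _ ⟨n, rfl⟩
    exact sup_le_sup (le_iSup (fun n => (S n).1.1) (n + 1)) (le_iSup (fun n => (S n).1.2) (n + 1))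
      (hin n)
  · intro x hx
    obtain ⟨n, hn⟩ := (hmem₀ x).1 hx
    exact (hmem₁ _).2 ⟨n, (S n).2.2.2.map₀ x hn⟩
  · intro x hx
    obtain ⟨n, hn⟩ := (hmem₁ x).1 hx
    exact (hmem₀ _).2 ⟨n, (S n).2.2.2.map₁ x hn⟩

/-- Projecting to one part and then applying `u` lands in the other part, which the same projection
kills. -/
theorem exists_sq_zero_add_of_isCompl (u : V →ₗ[F] V) {V₀ V₁ : Submodule F V}
    (hc : IsCompl V₀ V₁) (h₀ : ∀ x ∈ V₀, u x ∈ V₁) (h₁ : ∀ x ∈ V₁, u x ∈ V₀) :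
    ∃ b c : V →ₗ[F] V, b ∘ₗ b = 0 ∧ c ∘ₗ c = 0 ∧ u = b + c := by
  refine ⟨u ∘ₗ V₀.projection V₁ hc, u ∘ₗ V₁.projection V₀ hc.symm, ?_, ?_, ?_⟩
  · ext x
    have : V₀.projection V₁ hc (u (V₀.projection V₁ hc x)) = 0 :=
      (Submodule.projection_apply_eq_zero_iff hc).2
        (h₀ _ (Submodule.projection_apply_mem hc x))
    simp [this]
  · ext x
    have : V₁.projection V₀ hc.symm (u (V₁.projection V₀ hc.symm x)) = 0 :=
      (Submodule.projection_apply_eq_zero_iff hc.symm).2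
        (h₁ _ (Submodule.projection_apply_mem hc.symm x))
    simp [this]
  · ext x
    simp [← map_add, Submodule.projection_add_projection_eq_self hc x]

end HeightChain

/-! ### Column-finite matrices as endomorphisms -/

namespace ColumnFiniteMatrix

variable {F : Type*} [Field F]

/-- The matrix of an endomorphism of `ℕ →₀ F` in the standard basis. -/
noncomputable def ofEnd (f : (ℕ →₀ F) →ₗ[F] (ℕ →₀ F)) : ColumnFiniteMatrix F :=
  ⟨Matrix.of fun i j => f (Finsupp.single j 1) i, fun j =>
    (f (Finsupp.single j 1)).hasFiniteSupport⟩

theorem ofEnd_apply (f : (ℕ →₀ F) →ₗ[F] (ℕ →₀ F)) (i j : ℕ) :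
    (ofEnd f).1 i j = f (Finsupp.single j 1) i := rfl

theorem ofEnd_add (f g : (ℕ →₀ F) →ₗ[F] (ℕ →₀ F)) : ofEnd (f + g) = ofEnd f + ofEnd g := rfl

theorem ofEnd_comp (f g : (ℕ →₀ F) →ₗ[F] (ℕ →₀ F)) : ofEnd (f ∘ₗ g) = ofEnd f * ofEnd g := by
  refine Subtype.ext (Matrix.ext fun i j => ?_)
  rw [mul_apply]
  simp only [ofEnd_apply, LinearMap.comp_apply]
  generalize g (Finsupp.single j 1) = v
  rw [finsum_eq_sum_of_support_subset (s := v.support) _ (by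
    intro k hk
    simpa using right_ne_zero_of_mul hk)]
  conv_lhs => rw [← v.sum_single, Finsupp.sum, map_sum, Finsupp.finsetSum_apply]
  refine Finset.sum_congr rfl fun k _ => ?_
  rw [← mul_one (v k), ← smul_eq_mul, ← Finsupp.smul_single, map_smul]
  simp [mul_comm]

theorem isSquareZero_ofEnd {f : (ℕ →₀ F) →ₗ[F] (ℕ →₀ F)} (hf : f ∘ₗ f = 0) :
    IsSquareZero (ofEnd f) := by
  rw [IsSquareZero, ← ofEnd_comp, hf]
  rfl

/-- The `j`-th column of a column-finite matrix. -/
noncomputable def column (A : ColumnFiniteMatrix F) (j : ℕ) : ℕ →₀ F :=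
  Finsupp.ofSupportFinite (fun i => A.1 i j) (A.2 j)

theorem column_apply (A : ColumnFiniteMatrix F) (i j : ℕ) : column A j i = A.1 i j := rfl

/-- The endomorphism of `ℕ →₀ F` given by a column-finite matrix. -/
noncomputable def toEnd (A : ColumnFiniteMatrix F) : (ℕ →₀ F) →ₗ[F] (ℕ →₀ F) :=
  Finsupp.linearCombination F (column A)

theorem toEnd_single (A : ColumnFiniteMatrix F) (j : ℕ) :
    (toEnd A) (Finsupp.single j 1) = column A j := by
  simp [toEnd]

theorem ofEnd_toEnd (A : ColumnFiniteMatrix F) : ofEnd (toEnd A) = A :=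
  Subtype.ext (Matrix.ext fun i j => by rw [ofEnd_apply, toEnd_single, column_apply])

end ColumnFiniteMatrix

theorem mainTheorem7 {F : Type*} [Field F] (A : ColumnFiniteMatrix F)
    (hA : ColumnFiniteMatrix.IsStrictlyUpperTriangular A) :
    ∃ B C : ColumnFiniteMatrix F,
      ColumnFiniteMatrix.IsSquareZero B ∧ ColumnFiniteMatrix.IsSquareZero C ∧ A = B + C := by
  obtain ⟨V₀, V₁, hc, h₀, h₁⟩ := exists_isCompl_of_strictlyTriangular (ColumnFiniteMatrix.toEnd A)
    (fun j => Finsupp.single j (1 : F)) (by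
      simpa using (Finsupp.basisSingleOne (R := F) (ι := ℕ)).span_eq) (by
      intro n
      rw [ColumnFiniteMatrix.toEnd_single A]
      refine (Finsupp.mem_supported F _).2 ?_ |> fun h =>
        (Finsupp.supported_eq_span_single F (Set.Iio n)) ▸ h
      intro i hi
      by_contra h
      exact (Finsupp.mem_support_iff.1 hi) (hA i n (not_lt.1 h)))
  obtain ⟨b, c, hb, hc, hbc⟩ := exists_sq_zero_add_of_isCompl (ColumnFiniteMatrix.toEnd A) hc h₀ h₁
  exact ⟨ColumnFiniteMatrix.ofEnd b, ColumnFiniteMatrix.ofEnd c, ColumnFiniteMatrix.isSquareZero_ofEnd hb,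
    ColumnFiniteMatrix.isSquareZero_ofEnd hc, by
      rw [← ColumnFiniteMatrix.ofEnd_add, ← hbc, ColumnFiniteMatrix.ofEnd_toEnd A]⟩
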